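/- Let $G$ be a simple graph with $n \ge 3$ vertices, labelled by $\mathbf n = \{1,\dots,n\}$, with adjacency matrix $(a_{ij})$, and let $H_c$ be the number of Hamiltonian cycles of $G$ (counted as subgraphs, i.e. without a starting point or a direction). For real variables $t, t_1,\dots,t_n$ put $D_i=\sum_{j=1}^n a_{ij}t_j$, and let $\mathbf K(t,t_1,\dots,t_n)$ be the $n\times n$ matrix with diagonal entries $D_i t$ and off-diagonal entries $-a_{ij}t_j$ ($i\ne j$). Let $$D(t_1,\dots,t_n)=\frac{\partial}{\partial t}\det\mathbf K(t,t_1,\dots,t_n)\Big|_{t=1},$$ and for $0\le l\le n$ let $D^{(l)}=\sum_{I_l} D(t_1,\dots,t_n)$, where the sum runs over all $l$-element subsets $I_l\subseteq\mathbf n$, and where in the summand of $I_l$ the variables take the values $t_i=0$ for $i\in I_l$ and $t_i=1$ for $i\notin I_l$. Then $$H_c=\frac1{2n}\sum_{l=0}^n(-1)^l D^{(l)}.$$ Moreover, if $G$ is instead a digraph without loops on $n\ge 1$ vertices (arcs in both directions between two vertices are allowed), with $a_{ij}=1$ if there is an arc from $i$ to $j$ and $a_{ij}=0$ otherwise, and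 if $D^{(l)}$ is formed from this matrix $(a_{ij})$ in the same way, then the number of directed Hamiltonian cycles of $G$ (cyclic arrangements of all the vertices with an arc from each vertex to the next; for $n=2$ this is a pair of opposite arcs) is $$\frac1n\sum_{l=0}^n(-1)^l D^{(l)}.$$ -/

import Mathlib

namespace HamiltonianEnumeration

/-- The weighted out-degree `D_i = ∑_j a_{ij} t_j`. -/
def weightedDegree {V : Type*} [Fintype V] (A : Matrix V V ℝ) (x : V → ℝ) (i : V) : ℝ :=
  ∑ j, A i j * x j

/-- The matrix `K(t, t_1, …, t_n)`, with the variables `t_i` given by `x : V → ℝ`: its diagonal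
entries are `D_i t` and its off-diagonal entries are `-a_{ij} t_j`. -/
def kirchhoffMatrix {V : Type*} [Fintype V] [DecidableEq V] (A : Matrix V V ℝ) (t : ℝ)
    (x : V → ℝ) : Matrix V V ℝ :=
  Matrix.of fun i j => if i = j then weightedDegree A x i * t else -(A i j * x j)

/-- `D(t_1, …, t_n)`, the derivative of `det K(t, t_1, …, t_n)` in `t` at `t = 1`. -/
noncomputable def detDeriv {V : Type*} [Fintype V] [DecidableEq V] (A : Matrix V V ℝ)
    (x : V → ℝ) : ℝ :=
  deriv (fun t : ℝ => (kirchhoffMatrix A t x).det) 1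

/-- `D_l`: the sum over all `l`-element sets `I` of vertices of the value of `D(t_1, …, t_n)` at
`t_i = 0` for `i ∈ I` and `t_i = 1` for `i ∉ I`. -/
noncomputable def detDerivSum {V : Type*} [Fintype V] [DecidableEq V] (A : Matrix V V ℝ)
    (l : ℕ) : ℝ :=
  ∑ I ∈ (Finset.univ : Finset V).powersetCard l, detDeriv A fun i => if i ∈ I then 0 else 1

/-- The Hamiltonian cycles of a simple graph, each given by its set of edges, so that walks
that differ by the starting point or the direction are one cycle. -/
def hamiltonianCycles {V : Type*} [DecidableEq V] (G : SimpleGraph V) : Set (Set (Sym2 V)) :=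
  {E | ∃ (v : V) (w : G.Walk v v), w.IsHamiltonianCycle ∧ E = {e | e ∈ w.edges}}

/-- The number `H_c` of Hamiltonian cycles of a simple graph. -/
noncomputable def numHamiltonianCycles {V : Type*} [DecidableEq V] (G : SimpleGraph V) : ℕ :=
  (hamiltonianCycles G).ncard

/-- The directed Hamiltonian cycles of a digraph, each given by its set of arcs: list all the
vertices as `u 0, …, u (n - 1)`, each exactly once, so that there is an arc from every vertex of
the list to the next one, and from the last one to the first (`finRotate n` is the cyclic
successor on `Fin n`). Listings that differ by a rotation are one cycle. -/
def directedHamiltonianCycles {V : Type*} [Fintype V] (G : Digraph V) : Set (Set (V × V)) :=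
  {E | ∃ u : Fin (Fintype.card V) ≃ V,
    (∀ i, G.Adj (u i) (u (finRotate _ i))) ∧ E = Set.range fun i => (u i, u (finRotate _ i))}

/-- The number of directed Hamiltonian cycles of a digraph. -/
noncomputable def numDirectedHamiltonianCycles {V : Type*} [Fintype V] (G : Digraph V) : ℕ :=
  (directedHamiltonianCycles G).ncard

/-- The adjacency matrix of a digraph: `a_{ij} = 1` if there is an arc from `i` to `j`, and
`a_{ij} = 0` otherwise. -/
def digraphAdjMatrix {V : Type*} (G : Digraph V) [DecidableRel G.Adj] : Matrix V V ℝ :=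
  Matrix.of fun i j => if G.Adj i j then 1 else 0

end HamiltonianEnumeration

namespace HamiltonianEnumeration

open Polynomial

/-! Row `i` of `K` is `∑ j, a_ij t_j (t e_i - e_j)`, so multilinearity expands `det K` over maps `f
: V → V`, each weighted by the characteristic polynomial of its matrix. The alternating sum over
zeroed vertex sets is inclusion-exclusion: it leaves only bijective `f`. A permutation with cycle
lengths `c` has polynomial `∏ (t^c - 1)`, whose derivative at `1` vanishes unless there is a single
cycle, and is then `n`. Hence the sum is `n` times the number of cyclic permutations along arcs
(`alternating_sum_detDerivSum_eq_card`). These correspond to directed Hamiltonian cycles; for `n ≥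
3` an undirected cycle comes from exactly two, `π` and `π⁻¹` (`permEdges_eq_iff`). -/

/-- The matrix of a self-map `f`, with a `1` in row `i` at column `f i` and `0` elsewhere. -/
def functionMatrix {V : Type*} [DecidableEq V] (f : V → V) : Matrix V V ℝ :=
  Matrix.of fun i j => if f i = j then 1 else 0

/-! ### Expansion of the determinant and inclusion-exclusion -/

theorem det_kirchhoffMatrix {V : Type*} [Fintype V] [DecidableEq V] {A : Matrix V V ℝ}
    (hA : ∀ i, A i i = 0) (t : ℝ) (x : V → ℝ) :
    (kirchhoffMatrix A t x).det =
      ∑ f : V → V, (∏ i, A i (f i) * x (f i)) * (functionMatrix f).charpoly.eval t := by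
  have hrow : kirchhoffMatrix A t x = fun i => ∑ j, (A i j * x j) •
      (fun k => (if i = k then t else 0) - if j = k then 1 else 0 : V → ℝ) := by
    ext i k
    simp only [kirchhoffMatrix, weightedDegree, Matrix.of_apply, Finset.sum_apply, Pi.smul_apply,
      smul_eq_mul, mul_sub, Finset.sum_sub_distrib, mul_ite, mul_one, mul_zero,
      Finset.sum_ite_eq', Finset.mem_univ, if_true]
    split_ifs with h
    -- The expanded diagonal entry is `D_i t - a_ii x_i`; the absence of loops removes the last
    -- term.
    · subst h
      simp [hA, Finset.sum_mul]
    · simp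
  rw [hrow]
  refine (Matrix.detRowAlternating.toMultilinearMap.map_sum _).trans ?_
  refine Finset.sum_congr rfl fun f _ => ?_
  refine (Matrix.detRowAlternating.toMultilinearMap.map_smul_univ _ _).trans ?_
  rw [smul_eq_mul, Matrix.eval_charpoly]
  congr 1

theorem detDeriv_eq_sum {V : Type*} [Fintype V] [DecidableEq V] {A : Matrix V V ℝ}
    (hA : ∀ i, A i i = 0) (x : V → ℝ) :
    detDeriv A x = ∑ f : V → V,
      (∏ i, A i (f i) * x (f i)) * (functionMatrix f).charpoly.derivative.eval 1 := by
  unfold detDeriv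
  simp_rw [det_kirchhoffMatrix hA]
  refine HasDerivAt.deriv (HasDerivAt.fun_sum fun f _ => ?_)
  exact ((functionMatrix f).charpoly.hasDerivAt 1).const_mul _

/-- The product is the indicator that `I` avoids the image of `f`, and the signed sum over subsets
of the complement of the image vanishes unless that complement is empty. -/
theorem sum_neg_one_pow_mul_prod_indicator {V : Type*} [Fintype V] [DecidableEq V]
    (f : V → V) :
    ∑ I : Finset V, (-1 : ℝ) ^ I.card * ∏ i, (if f i ∈ I then 0 else 1 : ℝ) =
      if Function.Bijective f then 1 else 0 := by
  have h1 : ∀ I : Finset V, (∏ i, (if f i ∈ I then 0 else 1 : ℝ)) =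
      if I ∈ (Finset.univ.image f)ᶜ.powerset then 1 else 0 := by
    intro I
    split_ifs with h
    · refine Finset.prod_eq_one fun i _ => if_neg fun hi => ?_
      simpa using Finset.mem_powerset.1 h hi
    · have : ∃ i, f i ∈ I := by
        by_contra! hc
        refine h (Finset.mem_powerset.2 fun y hy => ?_)
        simp only [Finset.mem_compl, Finset.mem_image, Finset.mem_univ, true_and, not_exists]
        rintro i rfl
        exact hc i hy
      obtain ⟨i, hi⟩ := this
      exact Finset.prod_eq_zero (Finset.mem_univ i) (if_pos hi)
  simp_rw [h1, mul_ite, mul_one, mul_zero]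
  rw [Finset.sum_ite_mem, Finset.univ_inter]
  have h2 := congrArg (Int.cast : ℤ → ℝ)
    (Finset.sum_powerset_neg_one_pow_card (x := (Finset.univ.image f)ᶜ))
  push_cast at h2
  rw [h2]
  have h3 : (Finset.univ.image f)ᶜ = ∅ ↔ Function.Bijective f := by
    rw [Finset.compl_eq_empty_iff, ← Finset.coe_eq_univ, Finset.coe_image, Finset.coe_univ,
      Set.image_univ, Set.range_eq_univ, Finite.surjective_iff_bijective]
  simp only [h3]

theorem alternating_sum_detDerivSum {V : Type*} [Fintype V] [DecidableEq V] {A : Matrix V V ℝ}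
    (hA : ∀ i, A i i = 0) :
    ∑ l ∈ Finset.range (Fintype.card V + 1), (-1 : ℝ) ^ l * detDerivSum A l =
      ∑ π : Equiv.Perm V,
        (∏ i, A i (π i)) * (functionMatrix π).charpoly.derivative.eval 1 := by
  have h1 : ∑ l ∈ Finset.range (Fintype.card V + 1), (-1 : ℝ) ^ l * detDerivSum A l =
      ∑ I : Finset V, (-1 : ℝ) ^ I.card * detDeriv A fun i => if i ∈ I then 0 else 1 := by
    rw [← Finset.powerset_univ, Finset.sum_powerset, Finset.card_univ]
    refine Finset.sum_congr rfl fun l _ => ?_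
    rw [detDerivSum, Finset.mul_sum]
    exact Finset.sum_congr rfl fun I hI => by rw [(Finset.mem_powersetCard.1 hI).2]
  rw [h1]
  simp_rw [detDeriv_eq_sum hA, Finset.mul_sum]
  rw [Finset.sum_comm]
  have h2 : ∀ f : V → V, ∑ I : Finset V, (-1 : ℝ) ^ I.card *
      ((∏ i, A i (f i) * if f i ∈ I then 0 else 1) *
        (functionMatrix f).charpoly.derivative.eval 1) =
      if Function.Bijective f then
        (∏ i, A i (f i)) * (functionMatrix f).charpoly.derivative.eval 1 else 0 := by
    intro f
    have := congrArg (· * ((∏ i, A i (f i)) * (functionMatrix f).charpoly.derivative.eval 1))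
      (sum_neg_one_pow_mul_prod_indicator f)
    simp only [ite_mul, one_mul, zero_mul] at this
    rw [← this, Finset.sum_mul]
    refine Finset.sum_congr rfl fun I _ => ?_
    rw [Finset.prod_mul_distrib]
    ring
  rw [Finset.sum_congr rfl fun f _ => h2 f]
  symm
  refine Finset.sum_of_injOn (fun π : Equiv.Perm V => (π : V → V))
    (DFunLike.coe_injective.injOn) (fun _ _ => Finset.mem_coe.2 (Finset.mem_univ _)) ?_ ?_
  · intro f _ hf
    refine if_neg fun hb => hf ⟨Equiv.ofBijective f hb, by simp, rfl⟩
  · intro π _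
    rw [if_pos π.bijective]

/-! ### Characteristic polynomials of permutations -/

/-- As `p` is closed under `f`, each row of the block at `t = 1` sums to zero, so the all-ones
vector lies in its kernel. -/
theorem eval_one_det_toSquareBlockProp_charmatrix {V : Type*} [Fintype V] [DecidableEq V]
    (f : V → V) (p : V → Prop) [DecidablePred p] (hp : ∀ i, p i → p (f i)) {v : V} (hv : p v) :
    ((functionMatrix f).charmatrix.toSquareBlockProp p).det.eval 1 = 0 := by
  rw [← coe_evalRingHom, RingHom.map_det]
  refine Matrix.exists_mulVec_eq_zero_iff.1 ⟨fun _ => 1, fun h => one_ne_zero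
    (congrFun h ⟨v, hv⟩), ?_⟩
  ext i
  have hentry : ∀ j : {j // p j}, (evalRingHom (1 : ℝ)).mapMatrix
      ((functionMatrix f).charmatrix.toSquareBlockProp p) i j =
      (if i = j then 1 else 0) - if ⟨f i, hp i i.2⟩ = j then 1 else 0 := by
    intro j
    simp only [RingHom.mapMatrix_apply, Matrix.map_apply, Matrix.toSquareBlockProp_def,
      Matrix.of_apply, Matrix.charmatrix_apply, Matrix.diagonal_apply, functionMatrix,
      coe_evalRingHom, eval_sub, eval_C, Subtype.ext_iff]
    congr 1
    split_ifs <;> simp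
  simp [Matrix.mulVec, dotProduct, hentry]

/-- The cycle of `v` and its nonempty complement are both closed under `π`; each block contributes a
root `1`, so `1` is a multiple root. -/
theorem derivative_charpoly_eval_one_of_not_isCycleOn {V : Type*} [Fintype V] [DecidableEq V]
    {π : Equiv.Perm V} (hπ : ¬ π.IsCycleOn Set.univ) :
    (functionMatrix π).charpoly.derivative.eval 1 = 0 := by
  classical
  have : ∃ v w, ¬ π.SameCycle v w := by
    by_contra! hc
    exact hπ ⟨Set.bijOn_univ.2 π.bijective, fun x _ y _ => hc x y⟩
  obtain ⟨v, w, hvw⟩ := this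
  have hdet := Matrix.twoBlockTriangular_det (functionMatrix π).charmatrix (π.SameCycle v) (by
    intro i hi j hj
    have hij : i ≠ j := by rintro rfl; exact hi hj
    have hpij : π i ≠ j := by
      rintro rfl
      exact hi (Equiv.Perm.sameCycle_apply_right.1 hj)
    simp [functionMatrix, Matrix.charmatrix_apply_ne _ _ _ hij, hpij])
  rw [Matrix.charpoly, hdet, derivative_mul, eval_add, eval_mul, eval_mul,
    eval_one_det_toSquareBlockProp_charmatrix π _
      (fun i hi => Equiv.Perm.sameCycle_apply_right.2 hi) (Equiv.Perm.SameCycle.refl π v),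
    eval_one_det_toSquareBlockProp_charmatrix π (fun i => ¬ π.SameCycle v i)
      (fun i hi => mt Equiv.Perm.sameCycle_apply_right.1 hi) hvw]
  simp

/-- A nonzero Leibniz term needs `τ i ∈ {i, π i}` for all `i`. Once `τ` follows `π` at one vertex,
injectivity makes it do so along the whole cycle, so only `1` and `π` survive. -/
theorem charpoly_functionMatrix_of_isCycleOn {V : Type*} [Fintype V] [DecidableEq V]
    [Nonempty V] {π : Equiv.Perm V} (hπ : π.IsCycleOn Set.univ) (hne : ∀ i, π i ≠ i) :
    (functionMatrix π).charpoly = X ^ Fintype.card V - 1 := by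
  have hpi : (1 : Equiv.Perm V) ≠ π := by
    rintro rfl
    exact hne (Classical.arbitrary V) rfl
  rw [Matrix.charpoly, ← Matrix.det_transpose, Matrix.det_apply']
  have hcyc : π.IsCycle := Equiv.Perm.isCycle_iff_exists_isCycleOn.2
    ⟨Set.univ, ⟨_, trivial, _, trivial, hne (Classical.arbitrary V)⟩, hπ, fun _ _ => trivial⟩
  have hsupp : π.support = Finset.univ := by ext; simp [hne]
  rw [Finset.sum_eq_add (1 : Equiv.Perm V) π hpi]
  · have h1 : ∀ i, (functionMatrix π).charmatrix i i = X := fun i => by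
      simp [Matrix.charmatrix_apply_eq, functionMatrix, hne]
    have h2 : ∀ i, (functionMatrix π).charmatrix i (π i) = -1 := fun i => by
      simp [Matrix.charmatrix_apply_ne _ _ _ (hne i).symm, functionMatrix]
    -- The term of `π` is `sign π * (-1)^n` with `sign π = -(-1)^n`, that is `-1`.
    simp only [Matrix.transpose_apply, Equiv.Perm.coe_one, id, h1, h2, Finset.prod_const,
      Finset.card_univ, hcyc.sign, hsupp, Equiv.Perm.sign_one]
    push_cast
    rw [one_mul, neg_mul, ← mul_pow]
    simp [sub_eq_add_neg]
  · intro τ _ hτ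
    suffices h : ∃ i, (functionMatrix π).charmatrix i (τ i) = 0 by
      obtain ⟨i, hi⟩ := h
      rw [Finset.prod_eq_zero (Finset.mem_univ i) (by simpa using hi), mul_zero]
    by_contra! hc
    have hor : ∀ i, τ i = i ∨ τ i = π i := fun i => by
      by_contra! h
      exact hc i (by simp [Matrix.charmatrix_apply_ne _ _ _ h.1.symm, functionMatrix, h.2.symm])
    obtain ⟨v, hv⟩ : ∃ v, τ v ≠ v := by
      by_contra! h
      exact hτ.1 (Equiv.ext h)
    refine hτ.2 (Equiv.ext fun w => ?_)
    obtain ⟨k, rfl⟩ := hπ.exists_pow_eq' Set.finite_univ (Set.mem_univ v) (Set.mem_univ w)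
    clear hcyc
    induction k with
    | zero => simpa using (hor v).resolve_left hv
    | succ k ih =>
      rw [pow_succ', Equiv.Perm.mul_apply]
      refine (hor _).resolve_left fun h => ?_
      rw [← ih] at h
      exact hne _ (ih.symm.trans (τ.injective h))
  · simp
  · simp

/-- The abstract relation `R` covers graphs and digraphs at once. -/
theorem alternating_sum_detDerivSum_eq_card {V : Type*} [Fintype V] [DecidableEq V] [Nonempty V]
    {A : Matrix V V ℝ} {R : V → V → Prop} (hA0 : ∀ i j, ¬ R i j → A i j = 0)
    (hA1 : ∀ i j, R i j → A i j = 1) (hR : ∀ i, ¬ R i i) :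
    ∑ l ∈ Finset.range (Fintype.card V + 1), (-1 : ℝ) ^ l * detDerivSum A l =
      Fintype.card V *
        {π : Equiv.Perm V | π.IsCycleOn Set.univ ∧ ∀ i, R i (π i)}.ncard := by
  classical
  rw [alternating_sum_detDerivSum fun i => hA0 i i (hR i), Set.ncard_eq_toFinset_card',
    mul_comm, ← nsmul_eq_mul, ← Finset.sum_const]
  symm
  refine Finset.sum_subset_zero_on_sdiff (Finset.subset_univ _) ?_ ?_
  · intro π hπ
    have hπ' : π.IsCycleOn Set.univ → ∃ i, ¬ R i (π i) := by simpa using hπ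
    by_cases h : π.IsCycleOn Set.univ
    · obtain ⟨i, hi⟩ := hπ' h
      rw [Finset.prod_eq_zero (f := fun i => A i (π i)) (Finset.mem_univ i) (hA0 _ _ hi), zero_mul]
    · rw [derivative_charpoly_eval_one_of_not_isCycleOn h, mul_zero]
  · intro π hπ
    obtain ⟨h1, h2⟩ : π.IsCycleOn Set.univ ∧ ∀ i, R i (π i) := by simpa using hπ
    rw [Finset.prod_eq_one fun i _ => hA1 _ _ (h2 i), charpoly_functionMatrix_of_isCycleOn h1
      fun i hi => hR i (by simpa [hi] using h2 i)]
    simp [derivative_X_pow]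


/-! ### Cyclic permutations and directed Hamiltonian cycles -/

theorem isCycleOn_univ_of_forall_exists_pow {V : Type*} [Finite V] {π : Equiv.Perm V} {v : V}
    (h : ∀ w, ∃ k : ℕ, (π ^ k) v = w) : π.IsCycleOn Set.univ := by
  have hs : ∀ w, π.SameCycle v w := fun w => by
    obtain ⟨k, hk⟩ := h w
    exact ⟨k, by simpa using hk⟩
  exact ⟨Set.bijOn_univ.2 π.bijective, fun x _ y _ => (hs x).symm.trans (hs y)⟩

theorem pow_mod_card_apply {V : Type*} [Fintype V] {π : Equiv.Perm V}
    (hπ : π.IsCycleOn Set.univ) (k : ℕ) (v : V) :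
    (π ^ (k % Fintype.card V)) v = (π ^ k) v := by
  have h : π.IsCycleOn ((Finset.univ : Finset V) : Set V) := by simpa using hπ
  rw [h.pow_apply_eq_pow_apply (Finset.mem_univ v), Finset.card_univ]
  exact Nat.mod_modEq _ _

theorem injOn_pow_apply {V : Type*} [Fintype V] {π : Equiv.Perm V}
    (hπ : π.IsCycleOn Set.univ) (v : V) {i j : ℕ} (hi : i < Fintype.card V)
    (hj : j < Fintype.card V) (h : (π ^ i) v = (π ^ j) v) : i = j := by
  have h' : π.IsCycleOn ((Finset.univ : Finset V) : Set V) := by simpa using hπ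
  rw [h'.pow_apply_eq_pow_apply (Finset.mem_univ v), Finset.card_univ] at h
  exact Nat.ModEq.eq_of_lt_of_lt h hi hj

theorem exists_pow_lt_card_apply_eq {V : Type*} [Fintype V] {π : Equiv.Perm V}
    (hπ : π.IsCycleOn Set.univ) (v w : V) : ∃ k < Fintype.card V, (π ^ k) v = w := by
  have h' : π.IsCycleOn ((Finset.univ : Finset V) : Set V) := by simpa using hπ
  simpa using h'.exists_pow_eq (Finset.mem_univ v) (Finset.mem_univ w)

theorem coe_finRotate_eq_mod {n : ℕ} (i : Fin n) : (finRotate n i : ℕ) = (i + 1) % n := by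
  cases n with
  | zero => exact i.elim0
  | succ n => simp [Fin.val_add]

theorem isCycleOn_univ_iff_exists_equiv {V : Type*} [Fintype V] [Nonempty V]
    {π : Equiv.Perm V} :
    π.IsCycleOn Set.univ ↔
      ∃ u : Fin (Fintype.card V) ≃ V, ∀ i, π (u i) = u (finRotate _ i) := by
  constructor
  · intro hπ
    obtain ⟨v⟩ := ‹Nonempty V›
    have hbij : Function.Bijective fun i : Fin (Fintype.card V) => (π ^ (i : ℕ)) v := by
      refine ⟨fun i j h => Fin.ext (injOn_pow_apply hπ v i.2 j.2 h), fun w => ?_⟩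
      obtain ⟨k, hk, rfl⟩ := exists_pow_lt_card_apply_eq hπ v w
      exact ⟨⟨k, hk⟩, rfl⟩
    refine ⟨Equiv.ofBijective _ hbij, fun i => ?_⟩
    simp only [Equiv.ofBijective_apply, coe_finRotate_eq_mod, pow_mod_card_apply hπ, pow_succ',
      Equiv.Perm.mul_apply]
  · rintro ⟨u, hu⟩
    have hpos : 0 < Fintype.card V := Fintype.card_pos
    have hpow : ∀ k : ℕ, (π ^ k) (u ⟨0, hpos⟩) = u ⟨k % Fintype.card V, Nat.mod_lt _ hpos⟩ := by
      intro k
      induction k with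
      | zero => simp
      | succ k ih =>
        rw [pow_succ', Equiv.Perm.mul_apply, ih, hu]
        refine congrArg u (Fin.ext ?_)
        rw [coe_finRotate_eq_mod]
        exact Nat.mod_add_mod k _ 1
    refine isCycleOn_univ_of_forall_exists_pow (v := u ⟨0, hpos⟩) fun w => ⟨u.symm w, ?_⟩
    rw [hpow]
    simp [Nat.mod_eq_of_lt (u.symm w).2]

theorem directedHamiltonianCycles_eq_image {V : Type*} [Fintype V] [Nonempty V] (G : Digraph V) :
    directedHamiltonianCycles G = (fun π : Equiv.Perm V => Set.range fun v => (v, π v)) ''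
      {π | π.IsCycleOn Set.univ ∧ ∀ v, G.Adj v (π v)} := by
  ext E
  constructor
  · rintro ⟨u, hadj, rfl⟩
    have hu : ∀ i, (u.symm.trans ((finRotate _).trans u)) (u i) = u (finRotate _ i) := by simp
    refine ⟨u.symm.trans ((finRotate _).trans u),
      ⟨isCycleOn_univ_iff_exists_equiv.2 ⟨u, hu⟩, u.forall_congr_right.1 fun i => ?_⟩, ?_⟩
    · rw [hu]
      exact hadj i
    · refine (u.surjective.range_comp _).symm.trans (congrArg Set.range (funext fun i => ?_))
      exact congrArg (Prod.mk (u i)) (hu i)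
  · rintro ⟨π, ⟨hπ, hadj⟩, rfl⟩
    obtain ⟨u, hu⟩ := isCycleOn_univ_iff_exists_equiv.1 hπ
    refine ⟨u, fun i => hu i ▸ hadj (u i), ?_⟩
    simp only [← hu]
    exact (u.surjective.range_comp fun v => (v, π v)).symm

theorem numDirectedHamiltonianCycles_eq_ncard {V : Type*} [Fintype V] [Nonempty V]
    (G : Digraph V) : numDirectedHamiltonianCycles G =
      {π : Equiv.Perm V | π.IsCycleOn Set.univ ∧ ∀ v, G.Adj v (π v)}.ncard := by
  rw [numDirectedHamiltonianCycles, directedHamiltonianCycles_eq_image]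
  refine Set.ncard_image_of_injective _ fun π ρ h => Equiv.ext fun v => ?_
  have hv : (v, π v) ∈ Set.range fun v => (v, ρ v) := by
    rw [← show _ = _ from h]
    exact ⟨v, rfl⟩
  obtain ⟨w, hw⟩ := hv
  obtain ⟨rfl, h2⟩ := Prod.mk.inj hw
  exact h2.symm

/-! ### Undirected Hamiltonian cycles -/

/-- The set of unordered pairs `{v, π v}`. -/
def permEdges {V : Type*} (π : Equiv.Perm V) : Set (Sym2 V) :=
  Set.range fun v => s(v, π v)

theorem permEdges_inv {V : Type*} (π : Equiv.Perm V) : permEdges π⁻¹ = permEdges π := by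
  unfold permEdges
  rw [← π.surjective.range_comp]
  exact congrArg Set.range (funext fun v => by simp [Sym2.eq_swap])

theorem isCycleOn_univ_apply_apply_ne {V : Type*} [Fintype V] {π : Equiv.Perm V}
    (hπ : π.IsCycleOn Set.univ) (hcard : 3 ≤ Fintype.card V) (v : V) : π (π v) ≠ v := by
  intro h
  have := injOn_pow_apply hπ v (i := 2) (j := 0) (by omega) (by omega) (by simpa [pow_two] using h)
  omega

/-- Agreement propagates along the cycle of `π`: if `ρ` ran through the next edge backwards,
injectivity of `ρ` would make `π` swap two vertices, impossible for `n ≥ 3`. -/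
theorem eq_of_permEdges_eq {V : Type*} [Fintype V] {π ρ : Equiv.Perm V}
    (hπ : π.IsCycleOn Set.univ) (hcard : 3 ≤ Fintype.card V)
    (h : permEdges π = permEdges ρ) {v : V} (hv : ρ v = π v) : ρ = π := by
  have hor : ∀ w, ρ w = π w ∨ ρ (π w) = w := by
    intro w
    have hw : s(w, π w) ∈ permEdges ρ := h ▸ ⟨w, rfl⟩
    obtain ⟨x, hx⟩ := hw
    rcases Sym2.eq_iff.1 hx with ⟨rfl, h2⟩ | ⟨rfl, h2⟩
    · exact Or.inl h2
    · exact Or.inr h2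
  refine Equiv.ext fun w => ?_
  obtain ⟨k, -, rfl⟩ := exists_pow_lt_card_apply_eq hπ v w
  induction k with
  | zero => simpa using hv
  | succ k ih =>
    rw [pow_succ', Equiv.Perm.mul_apply]
    refine (hor _).resolve_right fun hc => ?_
    exact isCycleOn_univ_apply_apply_ne hπ hcard _ (ρ.injective (hc.trans ih.symm))

theorem permEdges_eq_iff {V : Type*} [Fintype V] {π ρ : Equiv.Perm V}
    (hπ : π.IsCycleOn Set.univ) (hcard : 3 ≤ Fintype.card V) :
    permEdges ρ = permEdges π ↔ ρ = π ∨ ρ = π⁻¹ := by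
  constructor
  · intro h
    obtain ⟨v⟩ : Nonempty V := Fintype.card_pos_iff.1 (by omega)
    have hw : s(v, ρ v) ∈ permEdges π := h ▸ ⟨v, rfl⟩
    obtain ⟨x, hx⟩ := hw
    rcases Sym2.eq_iff.1 hx with ⟨rfl, h2⟩ | ⟨h1, h2⟩
    · exact Or.inl (eq_of_permEdges_eq hπ hcard h.symm h2.symm)
    · refine Or.inr (eq_of_permEdges_eq (v := v) hπ.inv hcard (by rw [permEdges_inv, h]) ?_)
      rw [← h1, ← h2]
      exact (π.symm_apply_apply x).symm
  · rintro (rfl | rfl)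
    · rfl
    · exact permEdges_inv π

theorem exists_walk_pow {V : Type*} {G : SimpleGraph V} {π : Equiv.Perm V}
    (h : ∀ v, G.Adj v (π v)) (v : V) (m : ℕ) :
    ∃ p : G.Walk v ((π ^ m) v),
      p.support = (List.range (m + 1)).map (fun k => (π ^ k) v) ∧
      p.edges = (List.range m).map fun k => s((π ^ k) v, (π ^ (k + 1)) v) := by
  induction m with
  | zero => exact ⟨(.nil : G.Walk v v), rfl, rfl⟩
  | succ m ih =>
    obtain ⟨p, hs, he⟩ := ih
    have hadj : G.Adj ((π ^ m) v) ((π ^ (m + 1)) v) := by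
      rw [pow_succ', Equiv.Perm.mul_apply]
      exact h _
    refine ⟨p.concat hadj, ?_, ?_⟩
    · rw [SimpleGraph.Walk.support_concat, hs, List.range_succ (n := m + 1)]
      simp
    · rw [SimpleGraph.Walk.edges_concat, he, List.range_succ (n := m)]
      simp

theorem exists_isHamiltonianCycle_of_perm {V : Type*} [Fintype V] [DecidableEq V]
    {G : SimpleGraph V} {π : Equiv.Perm V} (hcard : 3 ≤ Fintype.card V)
    (hπ : π.IsCycleOn Set.univ) (h : ∀ v, G.Adj v (π v)) (v : V) :
    ∃ w : G.Walk v v, w.IsHamiltonianCycle ∧ permEdges π = {e | e ∈ w.edges} := by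
  obtain ⟨p, hs, he⟩ := exists_walk_pow h v (Fintype.card V)
  have hlen : p.length = Fintype.card V := by
    rw [← SimpleGraph.Walk.length_edges, he]
    simp
  have hv : (π ^ Fintype.card V) v = v := by
    rw [← pow_mod_card_apply hπ]
    simp
  refine ⟨p.copy rfl hv, ?_, ?_⟩
  · have hnil : ¬ (p.copy rfl hv).Nil := by
      rw [← SimpleGraph.Walk.length_eq_zero_iff]
      simp only [SimpleGraph.Walk.length_copy]
      omega
    rw [SimpleGraph.Walk.isHamiltonianCycle_iff_isCycle_and_length_eq,
      SimpleGraph.Walk.isCycle_iff_isPath_tail_and_le_length]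
    simp only [SimpleGraph.Walk.length_copy, hlen]
    refine ⟨⟨?_, hcard⟩, trivial⟩
    -- Dropping the first copy of `v` leaves the `n` vertices `π v, …, π^n v`, which are distinct.
    rw [SimpleGraph.Walk.isPath_def, SimpleGraph.Walk.support_tail_of_not_nil _ hnil,
      SimpleGraph.Walk.support_copy, hs, List.range_succ_eq_map]
    simp only [List.map_cons, List.tail_cons, List.map_map]
    refine List.Nodup.map_on (fun i hi j hj hij => ?_) List.nodup_range
    refine injOn_pow_apply hπ (π v) (List.mem_range.1 hi) (List.mem_range.1 hj) ?_
    simpa [pow_succ] using hij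
  · ext e
    simp only [SimpleGraph.Walk.edges_copy, he, permEdges, Set.mem_range, Set.mem_ofPred_eq,
      List.mem_map, List.mem_range]
    constructor
    · rintro ⟨w, rfl⟩
      obtain ⟨k, hk, rfl⟩ := exists_pow_lt_card_apply_eq hπ v w
      exact ⟨k, hk, by rw [pow_succ', Equiv.Perm.mul_apply]⟩
    · rintro ⟨k, -, rfl⟩
      exact ⟨(π ^ k) v, by rw [pow_succ', Equiv.Perm.mul_apply]⟩

theorem exists_perm_of_isHamiltonianCycle {V : Type*} [DecidableEq V]
    {G : SimpleGraph V} {v : V} {w : G.Walk v v} (hw : w.IsHamiltonianCycle) :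
    ∃ π : Equiv.Perm V, π.IsCycleOn Set.univ ∧ (∀ x, G.Adj x (π x)) ∧
      permEdges π = {e | e ∈ w.edges} := by
  have hnil := hw.isCycle.not_nil
  have hnd := hw.isCycle.nodup_dropLast_support
  -- The last vertex repeats the first; without it the support lists every vertex once, and
  -- `l.formPerm` is the cyclic successor.
  set l := w.support.dropLast with hl
  have hlen : l.length = w.length := by simp [hl]
  have hget : ∀ (i : ℕ) (hi : i < l.length), l[i] = w.getVert i := fun i hi => by
    simp [hl, SimpleGraph.Walk.getVert_eq_support_getElem w (show i ≤ w.length by omega)]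
  have hmem : ∀ x, x ∈ l := fun x => by
    rw [hl, ← w.tail_support_perm_dropLast_support.mem_iff,
      ← SimpleGraph.Walk.support_tail_of_not_nil _ hnil]
    exact hw.isHamiltonian_tail.mem_support x
  have hperm : ∀ i < w.length, l.formPerm (w.getVert i) = w.getVert (i + 1) := by
    intro i hi
    have h1 := List.formPerm_apply_getElem l hnd i (by omega)
    rw [hget, hget] at h1
    rw [h1, hlen]
    rcases Nat.lt_or_ge (i + 1) w.length with h | h
    · rw [Nat.mod_eq_of_lt h]
    · rw [show i + 1 = w.length by omega, Nat.mod_self, SimpleGraph.Walk.getVert_zero,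
        SimpleGraph.Walk.getVert_length]
  have hsurj : ∀ x, ∃ i < w.length, w.getVert i = x := fun x => by
    obtain ⟨i, hi, rfl⟩ := List.getElem_of_mem (hmem x)
    exact ⟨i, by omega, (hget i hi).symm⟩
  refine ⟨l.formPerm, ?_, fun x => ?_, ?_⟩
  · have h := hnd.isCycleOn_formPerm
    rwa [Set.eq_univ_of_forall (s := {a | a ∈ l}) hmem] at h
  · obtain ⟨i, hi, rfl⟩ := hsurj x
    rw [hperm i hi]
    exact w.adj_getVert_succ hi
  · ext e
    constructor
    · rintro ⟨x, rfl⟩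
      obtain ⟨i, hi, rfl⟩ := hsurj x
      exact (w.mk_mem_edges_iff_exists).2 ⟨i, hi, by rw [hperm i hi]⟩
    · intro he
      induction e with | h a b =>
      obtain ⟨i, hi, hab⟩ := (w.mk_mem_edges_iff_exists).1 he
      exact ⟨w.getVert i, by rw [← hab, ← hperm i hi]⟩

theorem hamiltonianCycles_eq_image {V : Type*} [Fintype V] [DecidableEq V]
    (hcard : 3 ≤ Fintype.card V) (G : SimpleGraph V) :
    hamiltonianCycles G =
      permEdges '' {π : Equiv.Perm V | π.IsCycleOn Set.univ ∧ ∀ v, G.Adj v (π v)} := by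
  ext E
  constructor
  · rintro ⟨v, w, hw, rfl⟩
    obtain ⟨π, hπ, hadj, hE⟩ := exists_perm_of_isHamiltonianCycle hw
    exact ⟨π, ⟨hπ, hadj⟩, hE⟩
  · rintro ⟨π, ⟨hπ, hadj⟩, rfl⟩
    obtain ⟨v⟩ : Nonempty V := Fintype.card_pos_iff.1 (by omega)
    exact ⟨v, exists_isHamiltonianCycle_of_perm hcard hπ hadj v⟩

/-- Every fibre of `permEdges` is a pair `{π, π⁻¹}`: the two differ because `n ≥ 3`, and symmetry of
adjacency admits both. -/
theorem two_mul_numHamiltonianCycles {V : Type*} [Fintype V] [DecidableEq V]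
    (hcard : 3 ≤ Fintype.card V) (G : SimpleGraph V) :
    2 * numHamiltonianCycles G =
      {π : Equiv.Perm V | π.IsCycleOn Set.univ ∧ ∀ v, G.Adj v (π v)}.ncard := by
  classical
  rw [numHamiltonianCycles, hamiltonianCycles_eq_image hcard, Set.ncard_eq_toFinset_card',
    Set.ncard_eq_toFinset_card', Set.toFinset_image]
  set S := {π : Equiv.Perm V | π.IsCycleOn Set.univ ∧ ∀ v, G.Adj v (π v)} with hS
  rw [Finset.card_eq_sum_card_image permEdges S.toFinset, Finset.sum_const_nat (m := 2),
    mul_comm]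
  intro E hE
  obtain ⟨π, hπS, rfl⟩ := Finset.mem_image.1 hE
  obtain ⟨hπ, hadj⟩ := Set.mem_toFinset.1 hπS
  have hne : π ≠ π⁻¹ := fun h => by
    obtain ⟨v⟩ : Nonempty V := Fintype.card_pos_iff.1 (by omega)
    refine isCycleOn_univ_apply_apply_ne hπ hcard v ?_
    nth_rewrite 1 [h]
    exact π.symm_apply_apply v
  rw [← Finset.card_pair hne]
  congr 1
  ext ρ
  simp only [Finset.mem_filter, Set.mem_toFinset, Finset.mem_insert, Finset.mem_singleton,
    permEdges_eq_iff hπ hcard, and_iff_right_iff_imp]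
  rintro (rfl | rfl)
  · exact ⟨hπ, hadj⟩
  · refine ⟨hπ.inv, fun v => ?_⟩
    simpa using (hadj (π⁻¹ v)).symm

end HamiltonianEnumeration

theorem mainTheorem3 {V : Type*} [Fintype V] [DecidableEq V] :
    (3 ≤ Fintype.card V → ∀ (G : SimpleGraph V) [DecidableRel G.Adj],
      (HamiltonianEnumeration.numHamiltonianCycles G : ℝ) =
        1 / (2 * (Fintype.card V : ℝ)) *
          ∑ l ∈ Finset.range (Fintype.card V + 1),
            (-1 : ℝ) ^ l * HamiltonianEnumeration.detDerivSum (G.adjMatrix ℝ) l) ∧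
    (1 ≤ Fintype.card V → ∀ (G : Digraph V) [DecidableRel G.Adj], (∀ v, ¬ G.Adj v v) →
      (HamiltonianEnumeration.numDirectedHamiltonianCycles G : ℝ) =
        1 / (Fintype.card V : ℝ) *
          ∑ l ∈ Finset.range (Fintype.card V + 1),
            (-1 : ℝ) ^ l *
              HamiltonianEnumeration.detDerivSum (HamiltonianEnumeration.digraphAdjMatrix G) l) := by
  constructor
  · intro hcard G _
    have : Nonempty V := Fintype.card_pos_iff.1 (by omega)
    have hne : (Fintype.card V : ℝ) ≠ 0 := Nat.cast_ne_zero.2 (by omega)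
    rw [HamiltonianEnumeration.alternating_sum_detDerivSum_eq_card (R := G.Adj)
      (fun i j h => by simp [h]) (fun i j h => by simp [h]) (fun i => G.irrefl),
      ← HamiltonianEnumeration.two_mul_numHamiltonianCycles hcard]
    push_cast
    field_simp
  · intro hcard G _ hG
    have : Nonempty V := Fintype.card_pos_iff.1 hcard
    have hne : (Fintype.card V : ℝ) ≠ 0 := Nat.cast_ne_zero.2 (by omega)
    rw [HamiltonianEnumeration.alternating_sum_detDerivSum_eq_card (R := G.Adj)
      (fun i j h => by simp [HamiltonianEnumeration.digraphAdjMatrix, h])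
      (fun i j h => by simp [HamiltonianEnumeration.digraphAdjMatrix, h]) hG,
      HamiltonianEnumeration.numDirectedHamiltonianCycles_eq_ncard]
    field_simp
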